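/- All graphs are simple. A strong immersion $\Phi:G\to H$ is an isomorphism of $G$ onto an induced subgraph of $H$; for a subgraph $K\subseteq G$, $\Phi[K]$ denotes the image of $K$. A ray is a one-way infinite path, and a graph is rayless if it contains no ray. A graph has rank $0$ if it is finite; for an ordinal $\alpha>0$ it has rank $\alpha$ if it has no smaller rank and there is a finite set $F$ of vertices such that every connected component of $G-F$ has rank smaller than $\alpha$. For an infinite cardinal $\kappa$, let $\mathbf A_\kappa(\mathcal C^e)$ be the class of connected rayless graphs with at most $\kappa$ vertices that contain no cycle of even length, and for an ordinal $\alpha$ let $\mathbf A_\kappa^\alpha(\mathcal C^e)$ be the class of those members that have rank strictly less than $\alpha$. An open ear of a subgraph $K$ of $G$ is a path in $G$ with at least one edge that meets $K$ exactly in its two end vertices (in particular, it has no edge in common with $K$). For a class $\mathcal C$ of graphs, a strongly universal family is a family $\mathcal F\subseteq\mathcal C$ such that every $G\in\mathcal C$ has a strong immersion into some $H\in\mathcal F$; if $\mathcal C$ admits such a family, its strong complexity $\mathrm{Stc}(\mathcal C)$ is the least cardinality of one. **Theorem.** Let $\kappa$ be an infinite cardinal. For every ordinal $\alpha$ with $0<\alpha<\kappa^+$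 there is a family $\mathcal F\subseteq\mathbf A_\kappa^\alpha(\mathcal C^e)$ such that 1. for every $G\in\mathbf A_\kappa^\alpha(\mathcal C^e)$ and every finite subgraph $K\subseteq G$ there are $H\in\mathcal F$ and a strong immersion $\Phi:G\to H$ such that, if $K$ has no open ear in $G$, then $\Phi[K]$ has no open ear in $H$; 2. $|\mathcal F|\le\kappa$. Moreover, $\mathbf A_\kappa(\mathcal C^e)$ admits a strongly universal family, and $\mathrm{Stc}(\mathbf A_\kappa(\mathcal C^e))=\kappa^+$. -/

import Mathlib

universe u v

open Cardinal

namespace RaylessGraphs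

/-- A graph, bundled with its vertex type, so that one can speak of classes and families of
graphs. -/
structure Grph where
  V : Type u
  graph : SimpleGraph V

/-- A graph is rayless if it contains no one-way infinite path. -/
def IsRayless {V : Type u} (G : SimpleGraph V) : Prop :=
  ¬ ∃ r : ℕ → V, Function.Injective r ∧ ∀ n, G.Adj (r n) (r (n + 1))

/-- `HasRank α G`: the graph `G` has rank `α` in the rayless hierarchy. The graphs of rank `0` are
the finite ones. For `α > 0`, a graph has rank `α` if it has no smaller rank and there is a finite
set `F` of vertices such that every connected component of `G - F` has some rank smaller
than `α`. -/
def HasRank (α : Ordinal.{u}) {V : Type u} (G : SimpleGraph V) : Prop :=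
  (α = 0 ∧ Finite V) ∨
    (α ≠ 0 ∧ (∀ β, β < α → ¬ HasRank β G) ∧
      ∃ F : Set V, F.Finite ∧
        ∀ C : (G.induce Fᶜ).ConnectedComponent, ∃ β, ∃ _ : β < α, HasRank β C.toSimpleGraph)
termination_by α

theorem hasRank_zero_iff {V : Type u} (G : SimpleGraph V) : HasRank 0 G ↔ Finite V := by
  rw [HasRank]
  simp

theorem hasRank_iff_of_ne_zero {α : Ordinal.{u}} (hα : α ≠ 0) {V : Type u} (G : SimpleGraph V) :
    HasRank α G ↔ (∀ β, β < α → ¬ HasRank β G) ∧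
      ∃ F : Set V, F.Finite ∧
        ∀ C : (G.induce Fᶜ).ConnectedComponent, ∃ β, β < α ∧ HasRank β C.toSimpleGraph := by
  conv_lhs => rw [HasRank]
  simp [hα]

/-- A graph is free of a family `𝒦` of graphs if no member of `𝒦` admits an immersion into it, an
immersion being a graph homomorphism that is injective on the vertices. -/
def IsFreeOf (𝒦 : Set Grph.{v}) {V : Type u} (G : SimpleGraph V) : Prop :=
  ∀ K ∈ 𝒦, K.graph.Free G

/-- The family of all even cycles: the cycles on `2 * k` vertices, for `k ≥ 2`. -/
def evenCycles : Set Grph.{0} :=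
  {K | ∃ k : ℕ, 2 ≤ k ∧ K = ⟨Fin (2 * k), SimpleGraph.cycleGraph (2 * k)⟩}

/-- The class of `𝒦`-free `κ`-rayless graphs: connected rayless graphs with at most `κ` vertices
which are free of `𝒦`. -/
def raylessClass (κ : Cardinal.{u}) (𝒦 : Set Grph.{v}) : Set Grph.{u} :=
  {G | G.graph.Connected ∧ #G.V ≤ κ ∧ IsRayless G.graph ∧ IsFreeOf 𝒦 G.graph}

/-- The class of `𝒦`-free `κ`-rayless graphs of rank strictly less than `α`. -/
def raylessClassBelow (κ : Cardinal.{u}) (α : Ordinal.{u}) (𝒦 : Set Grph.{v}) : Set Grph.{u} :=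
  {G | G ∈ raylessClass κ 𝒦 ∧ ∃ β, β < α ∧ HasRank β G.graph}

/-- A walk `p` of `G` is an open ear of the subgraph `K` if it is a path with at least one edge,
its end vertices are exactly those of its vertices that lie in `K`, and none of its edges is an
edge of `K`. -/
def IsOpenEar {V : Type u} {G : SimpleGraph V} (K : G.Subgraph) {a b : V} (p : G.Walk a b) :
    Prop :=
  p.IsPath ∧ 1 ≤ p.length ∧ (∀ w ∈ p.support, w ∈ K.verts ↔ w = a ∨ w = b) ∧
    ∀ e ∈ p.edges, e ∉ K.edgeSet

/-- The subgraph `K` has an open ear in `G`. -/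
def HasOpenEar {V : Type u} {G : SimpleGraph V} (K : G.Subgraph) : Prop :=
  ∃ (a b : V) (p : G.Walk a b), IsOpenEar K p

/-- `F` is a strongly universal family of the class `𝒞`: it is contained in `𝒞`, and every member
of `𝒞` admits a strong immersion into a member of `F`, that is, an isomorphism onto an induced
subgraph. -/
def IsStronglyUniversal (F 𝒞 : Set Grph.{u}) : Prop :=
  F ⊆ 𝒞 ∧ ∀ G ∈ 𝒞, ∃ H ∈ F, Nonempty (G.graph ↪g H.graph)

/-- The strong complexity of a class that admits a strongly universal family: the smallest
cardinality of such a family. -/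
noncomputable def strongComplexity (𝒞 : Set Grph.{u}) : Cardinal.{u + 1} :=
  sInf {c | ∃ F : Set Grph.{u}, IsStronglyUniversal F 𝒞 ∧ #F = c}

end RaylessGraphs

/-!
A connected graph without even cycles has, around every finite set of vertices, a finite
path-convex set `S`: every path between two vertices of `S` stays in `S`. Each component of
`G - S` is then attached to `S` through a single vertex, which has only finitely many neighbours in
the component, and any two of these neighbours are joined by paths of odd length only. If `S` also
witnesses that `G` has rank at most `α`, the components have smaller rank. So, given a family that
is universal for rank less than `α`, every graph of rank at most `α` embeds into a graph that arises
from a finite core by attaching `κ` copies of each member of the family in all possible ways, and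
there are only countably many finite cores. For the induction one must map the components so that
the odd-path condition on the neighbours survives, which is why the embeddings are required to
create no new paths between the vertices of a prescribed finite set. This condition also implies
the one on open ears.

For the lower bound, infinitely many disjoint copies of every member of a family of size `κ` can be
attached to a single vertex. If the resulting graph embeds into a member `H` of the family, then
`H` contains infinitely many disjoint copies of itself, contradicting that it has a rank.
-/

namespace RaylessGraphs

open SimpleGraph

section Walks

variable {V W : Type*} {G : SimpleGraph V} {H : SimpleGraph W}

theorem start_notMem_support_tail {a b : V} {p : G.Walk a b} (hp : p.IsPath) :
    a ∉ p.support.tail := by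
  have h := hp.support_nodup
  rw [← p.cons_tail_support] at h
  exact (List.nodup_cons.1 h).1

theorem mem_support_tail_of_ne {a b x : V} {p : G.Walk a b} (hx : x ∈ p.support) (h : x ≠ a) :
    x ∈ p.support.tail :=
  (p.mem_support_iff.1 hx).resolve_left h

theorem isPath_append {a b c : V} {p : G.Walk a b} {q : G.Walk b c} (hp : p.IsPath)
    (hq : q.IsPath) (h : ∀ x ∈ p.support, x ∈ q.support → x = b) : (p.append q).IsPath := by
  rw [Walk.isPath_def, Walk.support_append, List.nodup_append']
  refine ⟨hp.support_nodup, hq.support_nodup.tail, fun x hx hx' => ?_⟩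
  obtain rfl := h x hx (List.mem_of_mem_tail hx')
  exact start_notMem_support_tail hq hx'

theorem eq_of_mem_support_of_isPath_append {a b x y : V} {q : G.Walk a y} {r : G.Walk y b}
    (h : (q.append r).IsPath) (hxq : x ∈ q.support) (hxr : x ∈ r.support) : x = y :=
  by_contra fun hne => h.ne_of_mem_support_of_append hne hxq hxr rfl

theorem isCycle_append_of_internally_disjoint {a b : V} {p : G.Walk a b} {q : G.Walk b a}
    (hp : p.IsPath) (hq : q.IsPath) (h : ∀ x ∈ p.support, x ∈ q.support → x = a ∨ x = b)
    (hlen : 1 < p.length) : (p.append q).IsCycle := by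
  refine hp.isCycle_append hq (fun x hx hx' => ?_) (Or.inl hlen)
  rcases h x (List.mem_of_mem_tail hx) (List.mem_of_mem_tail hx') with rfl | rfl
  · exact start_notMem_support_tail hp hx
  · exact start_notMem_support_tail hq hx'

theorem one_lt_length_of_mem_support {a b x : V} {p : G.Walk a b} (hx : x ∈ p.support)
    (hxa : x ≠ a) (hxb : x ≠ b) : 1 < p.length := by
  cases p with
  | nil => simp_all
  | cons _ p => cases p with
    | nil => simp_all
    | cons => simp

theorem exists_eq_append_of_end_mem {Z : Set V} {a b : V} (p : G.Walk a b) (hb : b ∈ Z) :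
    ∃ z ∈ Z, ∃ (p' : G.Walk a z) (p'' : G.Walk z b), p = p'.append p'' ∧
      ∀ x ∈ p'.support, x ∈ Z → x = z := by
  induction p with
  | nil => exact ⟨_, hb, .nil, .nil, rfl, by simp⟩
  | @cons a _ _ h p ih =>
    by_cases ha : a ∈ Z
    · exact ⟨a, ha, .nil, .cons h p, rfl, by simp⟩
    obtain ⟨z, hz, p', p'', rfl, hp'⟩ := ih hb
    refine ⟨z, hz, .cons h p', p'', rfl, fun x hx hxZ => ?_⟩
    rcases List.mem_cons.1 (Walk.support_cons h p' ▸ hx) with rfl | hx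
    · exact absurd hxZ ha
    · exact hp' x hx hxZ

theorem exists_path_through_of_notMem {Z : Set V} {a b y : V} {p : G.Walk a b} (hp : p.IsPath)
    (ha : a ∈ Z) (hb : b ∈ Z) (hy : y ∈ p.support) (hyZ : y ∉ Z) :
    ∃ a' ∈ Z, ∃ b' ∈ Z, a' ≠ b' ∧ ∃ r : G.Walk a' b', r.IsPath ∧ y ∈ r.support ∧
      ∀ x ∈ r.support, x ∈ Z → x = a' ∨ x = b' := by
  obtain ⟨q, r, hq, hr, rfl⟩ := hp.mem_support_iff_exists_append.1 hy
  obtain ⟨a', ha', q', q'', hqq', hq'⟩ := exists_eq_append_of_end_mem q.reverse ha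
  obtain ⟨b', hb', r', r'', rfl, hr'⟩ := exists_eq_append_of_end_mem r hb
  have hq'path : q'.IsPath := Walk.IsPath.of_append_left (hqq' ▸ hq.reverse)
  have hdisj : ∀ x ∈ q'.support, x ∈ r'.support → x = y := fun x hxq hxr => by
    have hxq' : x ∈ q.reverse.support := hqq' ▸ q'.support_subset_support_append_left q'' hxq
    exact eq_of_mem_support_of_isPath_append hp (by simpa using hxq')
      (r'.support_subset_support_append_left r'' hxr)
  refine ⟨a', ha', b', hb', ?_, q'.reverse.append r', ?_, ?_, fun x hx hxZ => ?_⟩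
  · rintro rfl
    exact hyZ (hdisj a' q'.end_mem_support r'.end_mem_support ▸ ha')
  · exact isPath_append hq'path.reverse hr.of_append_left fun x hxq => hdisj x (by simpa using hxq)
  · simp [Walk.mem_support_append_iff]
  · rw [Walk.mem_support_append_iff, Walk.support_reverse, List.mem_reverse] at hx
    exact hx.imp (hq' x · hxZ) (hr' x · hxZ)

theorem exists_walk_map_eq (f : G ↪g H) {a b : V} (p : H.Walk (f a) (f b))
    (hp : ∀ z ∈ p.support, z ∈ Set.range f) : ∃ q : G.Walk a b, q.map f.toHom = p := by
  let e := f.isoInduceRange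
  have he : ∀ x, e.symm ⟨f x, x, rfl⟩ = x := fun x => e.symm_apply_apply x
  have hcomp : f.toHom.comp e.symm.toHom = (Embedding.induce (Set.range f)).toHom := by
    ext x
    exact congrArg Subtype.val (e.apply_symm_apply x)
  refine ⟨((p.induce _ hp).map e.symm.toHom).copy (he a) (he b), ?_⟩
  rw [Walk.map_copy, Walk.map_map, Walk.map_eq_of_eq _ _ hcomp, Walk.map_induce]
  exact Walk.copy_copy p _ _ _ _

theorem isCycle_cons_concat {v x y : V} {q : G.Walk x y} (hq : q.IsPath) (hv : v ∉ q.support)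
    (hxy : x ≠ y) (hvx : G.Adj v x) (hyv : G.Adj y v) :
    (Walk.cons hvx (q.concat hyv)).IsCycle := by
  refine (Walk.cons_isCycle_iff _ _).2 ⟨hq.concat hv hyv, fun he => ?_⟩
  rw [Walk.edges_concat, List.concat_eq_append, List.mem_append, List.mem_singleton] at he
  rcases he with he | he
  · exact hv (q.fst_mem_support_of_mem_edges he)
  · exact hxy (by grind)

theorem exists_path_of_mem_support_isCycle {a v : V} {c : G.Walk a a} (hc : c.IsCycle)
    (hv : v ∈ c.support) : ∃ (x y : V) (q : G.Walk x y), G.Adj v x ∧ G.Adj v y ∧ x ≠ y ∧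
      q.IsPath ∧ v ∉ q.support ∧ q.support ⊆ c.support ∧ c.length = q.length + 2 := by
  classical
  have hc' := hc.rotate hv
  rw [← c.length_rotate v hv]
  have hsub : (c.rotate v hv).support ⊆ c.support := fun z hz =>
    (Walk.mem_support_rotate_iff ..).1 hz
  generalize c.rotate v hv = d at hc' hsub ⊢
  cases d with
  | nil => exact absurd hc' Walk.not_isCycle_nil
  | @cons _ x _ hvx p =>
    obtain ⟨hp, he⟩ := (Walk.cons_isCycle_iff _ _).1 hc'
    cases p with
    | nil => exact absurd rfl hvx.ne
    | cons h p =>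
      obtain ⟨y, q, hyv, hq⟩ := Walk.exists_cons_eq_concat h p
      rw [hq] at hp he hsub ⊢
      obtain ⟨hqpath, hvq⟩ := (Walk.concat_isPath_iff hyv).1 hp
      refine ⟨x, y, q, hvx, hyv.symm, ?_, hqpath, hvq, fun z hz => hsub ?_, by simp⟩
      · rintro rfl
        exact he (by simp [Walk.edges_concat, Sym2.eq_swap])
      · simp [Walk.support_concat, hz]

theorem exists_paths_of_isCycle {v a b : V} {c : G.Walk v v} (hc : c.IsCycle)
    (ha : a ∈ c.support) (hb : b ∈ c.support) (hab : a ≠ b) :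
    ∃ p q : G.Walk a b, p.IsPath ∧ q.IsPath ∧ p.support ⊆ c.support ∧ q.support ⊆ c.support ∧
      (∀ x ∈ p.support, x ∈ q.support → x = a ∨ x = b) ∧ 3 ≤ p.length + q.length := by
  classical
  have hc' := hc.rotate ha
  have hmem : ∀ x, x ∈ (c.rotate a ha).support ↔ x ∈ c.support := fun x =>
    Walk.mem_support_rotate_iff ..
  obtain ⟨p, q, hpq⟩ := Walk.mem_support_iff_exists_append.1 ((hmem b).2 hb)
  have hlen := hc'.three_le_length
  rw [hpq] at hc' hlen
  simp only [hpq, Walk.mem_support_append_iff] at hmem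
  have hnodup := hc'.support_nodup
  rw [Walk.tail_support_append, List.nodup_append'] at hnodup
  refine ⟨p, q.reverse, hc'.isPath_of_append_left (Walk.not_nil_of_ne hab.symm),
    (hc'.isPath_of_append_right (Walk.not_nil_of_ne hab)).reverse, fun x hx => (hmem x).1 (.inl hx),
    fun x hx => (hmem x).1 (.inr (by simpa using hx)), fun x hxp hxq => ?_, by simpa using hlen⟩
  rw [Walk.support_reverse, List.mem_reverse] at hxq
  by_contra! hne
  exact hnodup.2.2 (mem_support_tail_of_ne hxp hne.1) (mem_support_tail_of_ne hxq hne.2)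

end Walks

section Attachment

variable {V : Type*} {G : SimpleGraph V} {S : Set V} {v : V}

/-- The set `S` is attached at the vertex `v ∉ S` if every edge leaving `S` ends in `v`, so that
`v` separates `S` from the remaining vertices. -/
def IsAttachedAt (G : SimpleGraph V) (S : Set V) (v : V) : Prop :=
  v ∉ S ∧ ∀ ⦃x⦄, x ∈ S → ∀ ⦃y⦄, y ∉ S → G.Adj x y → y = v

namespace IsAttachedAt

theorem mem_support (hS : IsAttachedAt G S v) {a b : V} (p : G.Walk a b) (ha : a ∈ S)
    (hb : b ∉ S) : v ∈ p.support := by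
  obtain ⟨d, hd, hfst, hsnd⟩ := p.exists_boundary_dart S ha hb
  rw [← hS.2 hfst hsnd d.adj]
  exact p.dart_snd_mem_support_of_mem_darts hd

theorem notMem_support_of_isPath (hS : IsAttachedAt G S v) {a b x : V} {p : G.Walk a b}
    (hp : p.IsPath) (ha : a ∉ S) (hb : b ∉ S) (hx : x ∈ S) : x ∉ p.support := by
  intro hxp
  obtain ⟨q, r, -, -, rfl⟩ := hp.mem_support_iff_exists_append.1 hxp
  have hvq : v ∈ q.support := by simpa using hS.mem_support q.reverse hx ha
  exact hS.1 (eq_of_mem_support_of_isPath_append hp hvq (hS.mem_support r hx hb) ▸ hx)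

theorem support_subset_insert_of_isCycle (hS : IsAttachedAt G S v) {a x : V} {c : G.Walk a a}
    (hc : c.IsCycle) (hx : x ∈ S) (hxc : x ∈ c.support) : ∀ y ∈ c.support, y ∈ insert v S := by
  intro y hyc
  by_contra hy
  rw [Set.mem_insert_iff, not_or] at hy
  have hxy : y ≠ x := fun h => hy.2 (h ▸ hx)
  obtain ⟨p, q, -, -, -, -, hpq, -⟩ := exists_paths_of_isCycle hc hxc hyc hxy.symm
  rcases hpq v (hS.mem_support p hx hy.2) (hS.mem_support q hx hy.2) with h | h
  · exact hS.1 (h ▸ hx)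
  · exact hy.1 h.symm

end IsAttachedAt

end Attachment

section OddCycles

variable {V W : Type*} {G : SimpleGraph V} {H : SimpleGraph W}

/-- All cycles of `G` have odd length, which is the same as being free of even cycles. -/
def OddCycles (G : SimpleGraph V) : Prop :=
  ∀ ⦃v : V⦄ (c : G.Walk v v), c.IsCycle → Odd c.length

/-- All paths between distinct vertices of `N` have odd length. This is what `N` has to satisfy for
joining a new vertex to all vertices of `N` to create no even cycle. -/
def OddPaths (G : SimpleGraph V) (N : Set V) : Prop :=
  ∀ ⦃x⦄, x ∈ N → ∀ ⦃y⦄, y ∈ N → x ≠ y → ∀ p : G.Walk x y, p.IsPath → Odd p.length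

theorem isFreeOf_evenCycles_iff {V : Type u} {G : SimpleGraph V} :
    IsFreeOf evenCycles G ↔ OddCycles G := by
  constructor
  · intro h v c hc
    by_contra hodd
    obtain ⟨k, hk⟩ := Nat.not_odd_iff_even.1 hodd
    have hlen := hc.three_le_length
    refine h ⟨Fin (2 * k), cycleGraph (2 * k)⟩ ⟨k, by omega, rfl⟩ ?_
    exact (cycleGraph_isContained_iff (by omega)).2 ⟨v, c, hc, by omega⟩
  · rintro h K ⟨k, hk, rfl⟩ hcon
    obtain ⟨v, c, hc, hlen⟩ := (cycleGraph_isContained_iff (by omega)).1 hcon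
    exact Nat.not_odd_iff_even.2 (even_two_mul k) (hlen ▸ h c hc)

theorem oddCycles_of_subsingleton [Subsingleton V] : OddCycles G := fun _ c hc =>
  absurd (Subsingleton.elim _ _) (c.adj_snd hc.not_nil).ne

theorem OddCycles.of_isContained (h : OddCycles H) (hGH : G ⊑ H) : OddCycles G := by
  obtain ⟨f⟩ := hGH
  intro v c hc
  simpa using h _ (hc.map f.injective)

theorem OddCycles.odd_length_of_adj (h : OddCycles G) {v x y : V} {q : G.Walk x y} (hq : q.IsPath)
    (hv : v ∉ q.support) (hxy : x ≠ y) (hvx : G.Adj v x) (hvy : G.Adj v y) : Odd q.length := by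
  have := h _ (isCycle_cons_concat hq hv hxy hvx hvy.symm)
  simp only [Walk.length_cons, Walk.length_concat] at this
  grind

theorem OddCycles.oddPaths_neighbors (h : OddCycles G) (f : H →g G) (hf : Function.Injective f)
    {v : V} (hv : v ∉ Set.range f) : OddPaths H {x | G.Adj v (f x)} := by
  intro x hx y hy hxy p hp
  have hvp : v ∉ (p.map f).support := by
    rw [Walk.support_map, List.mem_map]
    rintro ⟨z, -, rfl⟩
    exact hv ⟨z, rfl⟩
  simpa using h.odd_length_of_adj (hp.map hf) hvp (hf.ne hxy) hx hy

theorem OddCycles.odd_length_of_support_subset_insert (hH : OddCycles H) (f : H ↪g G) {v : V}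
    (hN : OddPaths H {x | G.Adj v (f x)}) {a : V} {c : G.Walk a a} (hc : c.IsCycle)
    (hcf : ∀ z ∈ c.support, z ∈ insert v (Set.range f)) : Odd c.length := by
  by_cases hv : v ∈ c.support
  · obtain ⟨x, y, q, hvx, hvy, hxy, hq, hvq, hqc, hlen⟩ := exists_path_of_mem_support_isCycle hc hv
    have hqf : ∀ z ∈ q.support, z ∈ Set.range f := fun z hz =>
      (hcf z (hqc hz)).resolve_left fun h => hvq (h ▸ hz)
    obtain ⟨x, rfl⟩ := hqf x q.start_mem_support
    obtain ⟨y, rfl⟩ := hqf y q.end_mem_support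
    obtain ⟨r, rfl⟩ := exists_walk_map_eq f q hqf
    have hr := hN hvx hvy (by rintro rfl; exact hxy rfl) r
      ((Walk.isPath_map_iff_of_injective f.injective).1 hq)
    rw [hlen, Walk.length_map]
    exact hr.add_even even_two
  · have hcf' : ∀ z ∈ c.support, z ∈ Set.range f := fun z hz =>
      (hcf z hz).resolve_left fun h => hv (h ▸ hz)
    obtain ⟨a, rfl⟩ := hcf' a c.start_mem_support
    obtain ⟨d, rfl⟩ := exists_walk_map_eq f c hcf'
    rw [Walk.length_map]
    exact hH d ((Walk.isCycle_map_iff_of_injective f.injective).1 hc)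

/-- Among the lengths of three internally disjoint paths, two have the same parity. -/
theorem OddCycles.false_of_theta (h : OddCycles G) {a b : V} {p q r : G.Walk a b}
    (hp : p.IsPath) (hq : q.IsPath) (hr : r.IsPath) (hplen : 1 < p.length) (hqlen : 1 < q.length)
    (hpq : ∀ x ∈ p.support, x ∈ q.support → x = a ∨ x = b)
    (hpr : ∀ x ∈ p.support, x ∈ r.support → x = a ∨ x = b)
    (hqr : ∀ x ∈ q.support, x ∈ r.support → x = a ∨ x = b) : False := by
  have hodd : ∀ {p q : G.Walk a b}, p.IsPath → q.IsPath → 1 < p.length →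
      (∀ x ∈ p.support, x ∈ q.support → x = a ∨ x = b) → Odd (p.length + q.length) :=
    fun hp hq hlen hpq => by
      simpa using h _
        (isCycle_append_of_internally_disjoint hp hq.reverse (by simpa using hpq) hlen)
  have hpq' := hodd hp hq hplen hpq
  have hpr' := hodd hp hr hplen hpr
  have hqr' := hodd hq hr hqlen hqr
  grind

end OddCycles

section PathConvex

variable {V : Type*} {G : SimpleGraph V} {S : Set V}

/-- A set of vertices is path-convex if it contains all paths between its vertices. -/
def PathConvex (G : SimpleGraph V) (S : Set V) : Prop :=
  ∀ ⦃a⦄, a ∈ S → ∀ ⦃b⦄, b ∈ S → ∀ p : G.Walk a b, p.IsPath → ∀ x ∈ p.support, x ∈ S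

theorem pathConvex_singleton (a : V) : PathConvex G {a} := by
  rintro _ rfl _ rfl p hp x hx
  simpa [(Walk.isPath_iff_nil.1 hp).eq_nil] using hx

theorem PathConvex.induce_connected (hS : PathConvex G S) (hG : G.Preconnected)
    (hne : S.Nonempty) : (G.induce S).Connected := by
  classical
  obtain ⟨r, hr⟩ := hne
  refine (connected_iff_exists_forall_reachable _).2 ⟨⟨r, hr⟩, fun x => ?_⟩
  obtain ⟨w⟩ := hG r x
  exact ⟨w.bypass.induce S (hS hr x.2 _ w.bypass_isPath)⟩

theorem PathConvex.support_subset_union (hG : G.Preconnected) {Z : Set V} (hS : PathConvex G S)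
    (hZ : PathConvex G Z) {s : V} (hsS : s ∈ S) (hsZ : s ∈ Z) {a b : V} (ha : a ∈ S) (hb : b ∈ Z)
    (p : G.Walk a b) (hp : p.IsPath) : ∀ x ∈ p.support, x ∈ S ∪ Z := by
  classical
  intro x hx
  obtain ⟨t, ht, q, r, hqr, hqS⟩ := exists_eq_append_of_end_mem p.reverse ha
  have hqrpath : (q.append r).IsPath := hqr ▸ hp.reverse
  obtain ⟨w⟩ := hG s t
  -- Prolonging `q` inside `S` to the common vertex `s` turns it into a path with both ends in `Z`.
  have hpath : (w.bypass.append q.reverse).IsPath :=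
    isPath_append w.bypass_isPath hqrpath.of_append_left.reverse fun y hyw hyq =>
      hqS y (by simpa using hyq) (hS hsS ht _ w.bypass_isPath y hyw)
  have hxqr : x ∈ q.support ∨ x ∈ r.support := by
    rw [← Walk.mem_support_append_iff, ← hqr]
    simpa using hx
  rcases hxqr with hxq | hxr
  · exact Or.inr (hZ hsZ hb _ hpath x (by simp [Walk.mem_support_append_iff, hxq]))
  · exact Or.inl (hS ht ha r hqrpath.of_append_right x hxr)

theorem PathConvex.union (hG : G.Preconnected) {Z : Set V} (hS : PathConvex G S)
    (hZ : PathConvex G Z) (hSZ : (S ∩ Z).Nonempty) : PathConvex G (S ∪ Z) := by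
  obtain ⟨s, hsS, hsZ⟩ := hSZ
  rintro a (ha | ha) b (hb | hb) p hp
  · exact fun x hx => Or.inl (hS ha hb p hp x hx)
  · exact hS.support_subset_union hG hZ hsS hsZ ha hb p hp
  · rw [Set.union_comm]
    exact hZ.support_subset_union hG hS hsZ hsS ha hb p hp
  · exact fun x hx => Or.inr (hZ ha hb p hp x hx)

theorem OddCycles.pathConvex_of_isCycle (h : OddCycles G) {v : V} {c : G.Walk v v}
    (hc : c.IsCycle) : PathConvex G {x | x ∈ c.support} := by
  intro a ha b hb p hp y hy
  by_contra hyc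
  obtain ⟨a', ha', b', hb', hne, r, hr, hyr, hrc⟩ :=
    exists_path_through_of_notMem hp ha hb hy hyc
  obtain ⟨q₁, q₂, hq₁, hq₂, hq₁c, hq₂c, hq₁q₂, hlen⟩ := exists_paths_of_isCycle hc ha' hb' hne
  have hrlen : 1 < r.length :=
    one_lt_length_of_mem_support hyr (fun h => hyc (h ▸ ha')) (fun h => hyc (h ▸ hb'))
  have hrq₁ := fun x hxr hxq => hrc x hxr (hq₁c hxq)
  have hrq₂ := fun x hxr hxq => hrc x hxr (hq₂c hxq)
  by_cases hq₁len : 1 < q₁.length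
  · exact h.false_of_theta hr hq₁ hq₂ hrlen hq₁len hrq₁ hrq₂ hq₁q₂
  · exact h.false_of_theta hr hq₂ hq₁ hrlen (by omega) hrq₂ hrq₁ fun x hx₂ hx₁ => hq₁q₂ x hx₁ hx₂

theorem pathConvex_pair_of_forall_length_le {a b : V}
    (h : ∀ p : G.Walk a b, p.IsPath → p.length ≤ 1) : PathConvex G {a, b} := by
  have key : ∀ p : G.Walk a b, p.IsPath → ∀ x ∈ p.support, x ∈ ({a, b} : Set V) := by
    intro p hp x hx
    by_contra hxab
    rw [Set.mem_insert_iff, Set.mem_singleton_iff, not_or] at hxab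
    exact absurd (one_lt_length_of_mem_support hx hxab.1 hxab.2) (h p hp).not_gt
  rintro a' (rfl | rfl) b' (rfl | rfl) p hp x hx
  · exact Or.inl (pathConvex_singleton _ rfl rfl p hp x hx)
  · exact key p hp x hx
  · exact key p.reverse hp.reverse x (by simpa using hx)
  · exact Or.inr (pathConvex_singleton _ rfl rfl p hp x hx)

theorem OddCycles.exists_finite_pathConvex_of_adj (h : OddCycles G) {a b : V} (hab : G.Adj a b) :
    ∃ Z : Set V, Z.Finite ∧ a ∈ Z ∧ b ∈ Z ∧ PathConvex G Z := by
  by_cases hlen : ∀ p : G.Walk a b, p.IsPath → p.length ≤ 1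
  · exact ⟨{a, b}, by simp, by simp, by simp, pathConvex_pair_of_forall_length_le hlen⟩
  · push Not at hlen
    obtain ⟨p, hp, hlen⟩ := hlen
    have hc : (p.append hab.symm.toWalk).IsCycle :=
      isCycle_append_of_internally_disjoint hp (Walk.IsPath.of_adj hab.symm)
        (fun x _ hx => by simpa [or_comm] using hx) hlen
    exact ⟨_, List.finite_toSet _, by simp, by simp, h.pathConvex_of_isCycle hc⟩

theorem OddCycles.exists_finite_pathConvex_pair (h : OddCycles G) (hG : G.Preconnected) (a b : V) :
    ∃ Z : Set V, Z.Finite ∧ a ∈ Z ∧ b ∈ Z ∧ PathConvex G Z := by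
  obtain ⟨p⟩ := hG a b
  induction p with
  | nil => exact ⟨_, Set.finite_singleton _, rfl, rfl, pathConvex_singleton _⟩
  | cons hadj _ ih =>
    obtain ⟨S, hSfin, ha, hb, hS⟩ := ih
    obtain ⟨Z, hZfin, ha', hb', hZ⟩ := h.exists_finite_pathConvex_of_adj hadj
    exact ⟨Z ∪ S, hZfin.union hSfin, Or.inl ha', Or.inr hb, hZ.union hG hS ⟨_, hb', ha⟩⟩

theorem OddCycles.exists_finite_pathConvex_superset (h : OddCycles G) (hG : G.Connected)
    {F : Set V} (hF : F.Finite) : ∃ S, F ⊆ S ∧ S.Finite ∧ S.Nonempty ∧ PathConvex G S := by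
  obtain ⟨r⟩ := hG.nonempty
  suffices ∃ S, F ⊆ S ∧ S.Finite ∧ r ∈ S ∧ PathConvex G S by
    obtain ⟨S, hFS, hSfin, hr, hS⟩ := this
    exact ⟨S, hFS, hSfin, ⟨r, hr⟩, hS⟩
  induction F, hF using Set.Finite.induction_on with
  | empty => exact ⟨{r}, by simp, by simp, rfl, pathConvex_singleton r⟩
  | @insert a F _ _ ih =>
    obtain ⟨S, hFS, hSfin, hrS, hS⟩ := ih
    obtain ⟨Z, hZfin, hrZ, ha, hZ⟩ := h.exists_finite_pathConvex_pair hG.preconnected r a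
    exact ⟨S ∪ Z, Set.insert_subset (Or.inr ha) (hFS.trans Set.subset_union_left),
      hSfin.union hZfin, Or.inl hrS, hS.union hG.preconnected hZ ⟨r, hrS, hrZ⟩⟩

theorem OddCycles.finite_neighbors (h : OddCycles G) {W : Type*} {H : SimpleGraph W}
    (hH : H.Preconnected) (f : H →g G) (hf : Function.Injective f) {v : V}
    (hv : v ∉ Set.range f) : {x | G.Adj v (f x)}.Finite := by
  classical
  rcases Set.eq_empty_or_nonempty {x | G.Adj v (f x)} with hN | ⟨x, hx⟩
  · exact hN ▸ Set.finite_empty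
  obtain ⟨Z, hZfin, hvZ, hxZ, hZ⟩ := h.exists_finite_pathConvex_of_adj hx
  refine (hZfin.preimage hf.injOn).subset fun y hy => ?_
  obtain ⟨p⟩ := hH x y
  have hvp : v ∉ (p.bypass.map f).support := by
    rw [Walk.support_map, List.mem_map]
    rintro ⟨z, -, rfl⟩
    exact hv ⟨z, rfl⟩
  exact hZ hxZ hvZ _ ((p.bypass_isPath.map hf).concat hvp (Adj.symm hy)) _
    (by simpa [Walk.support_concat] using Or.inl ⟨y, p.bypass.end_mem_support, rfl⟩)

end PathConvex

section Components

variable {V : Type*} {G : SimpleGraph V} {A S : Set V}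

/-- The inclusion into `G` of a component of an induced subgraph of `G`. -/
def componentEmbedding (C : (G.induce A).ConnectedComponent) : C.toSimpleGraph ↪g G :=
  (Embedding.induce A).comp (Embedding.induce C.supp)

theorem componentEmbedding_mem (C : (G.induce A).ConnectedComponent) (x) :
    componentEmbedding C x ∈ A :=
  x.1.2

theorem mem_of_adj_componentEmbedding {C : (G.induce Sᶜ).ConnectedComponent} {x} {y : V}
    (hxy : G.Adj (componentEmbedding C x) y) (hy : y ∉ Set.range (componentEmbedding C)) :
    y ∈ S := by
  by_contra hyS
  have hadj : (G.induce Sᶜ).Adj x.1 ⟨y, hyS⟩ := hxy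
  exact hy ⟨⟨⟨y, hyS⟩, C.mem_supp_of_adj_mem_supp x.2 hadj⟩, rfl⟩

theorem exists_adj_componentEmbedding (hG : G.Preconnected) (hS : S.Nonempty)
    (C : (G.induce Sᶜ).ConnectedComponent) : ∃ v ∈ S, ∃ x, G.Adj v (componentEmbedding C x) := by
  obtain ⟨s, hs⟩ := hS
  obtain ⟨c⟩ := C.connected_toSimpleGraph.nonempty
  obtain ⟨p⟩ := hG (componentEmbedding C c) s
  obtain ⟨d, -, ⟨x, hx⟩, hd⟩ := p.exists_boundary_dart (Set.range (componentEmbedding C)) ⟨c, rfl⟩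
    (by rintro ⟨x, rfl⟩; exact componentEmbedding_mem C x hs)
  have hadj : G.Adj (componentEmbedding C x) d.snd := hx ▸ d.adj
  exact ⟨d.snd, mem_of_adj_componentEmbedding hadj hd, x, hadj.symm⟩

theorem PathConvex.eq_of_adj_componentEmbedding (hS : PathConvex G S)
    {C : (G.induce Sᶜ).ConnectedComponent} {v w : V} (hv : v ∈ S) (hw : w ∈ S) {x y}
    (hvx : G.Adj v (componentEmbedding C x)) (hwy : G.Adj w (componentEmbedding C y)) : v = w := by
  classical
  by_contra hvw
  obtain ⟨p⟩ := C.connected_toSimpleGraph.preconnected x y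
  have hpS : ∀ z ∈ (p.bypass.map (componentEmbedding C).toHom).support, z ∉ S := by
    rw [Walk.support_map]
    intro z hz
    obtain ⟨z, -, rfl⟩ := List.mem_map.1 hz
    exact componentEmbedding_mem C z
  have hpath :
      (Walk.cons hvx ((p.bypass.map (componentEmbedding C).toHom).concat hwy.symm)).IsPath :=
    ((p.bypass_isPath.map (componentEmbedding C).injective).concat
      (fun h => hpS w h hw) _).cons <| by
      rw [Walk.support_concat, List.mem_append, List.mem_singleton]
      exact fun h => h.elim (fun h => hpS v h hv) hvw
  exact componentEmbedding_mem C x (hS hv hw _ hpath _ (by simp [Walk.support_concat]))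

theorem PathConvex.exists_isAttachedAt (hS : PathConvex G S) (hne : S.Nonempty)
    (hG : G.Preconnected) (C : (G.induce Sᶜ).ConnectedComponent) :
    ∃ v ∈ S, IsAttachedAt G (Set.range (componentEmbedding C)) v ∧
      ∃ x, G.Adj v (componentEmbedding C x) := by
  obtain ⟨v, hv, x, hvx⟩ := exists_adj_componentEmbedding hG hne C
  refine ⟨v, hv, ⟨?_, ?_⟩, x, hvx⟩
  · rintro ⟨y, rfl⟩
    exact componentEmbedding_mem C y hv
  · rintro _ ⟨y, rfl⟩ w hw hyw
    exact hS.eq_of_adj_componentEmbedding (mem_of_adj_componentEmbedding hyw hw) hv hyw.symm hvx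

end Components

section ReflectsPaths

variable {V W : Type*} {G : SimpleGraph V} {H : SimpleGraph W} {Φ : G ↪g H} {S T : Set V}

/-- The embedding `Φ` reflects paths on `S` if every path of `H` between the images of two vertices
of `S` is the image of a walk of `G`: embedding `G` into `H` creates no new paths between vertices
of `S`, and in particular no new open ears of subgraphs of `G` on vertices of `S`. -/
def ReflectsPaths (Φ : G ↪g H) (S : Set V) : Prop :=
  ∀ ⦃a⦄, a ∈ S → ∀ ⦃b⦄, b ∈ S → ∀ p : H.Walk (Φ a) (Φ b), p.IsPath →
    ∃ q : G.Walk a b, q.map Φ.toHom = p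

theorem ReflectsPaths.mono (h : ReflectsPaths Φ T) (hST : S ⊆ T) : ReflectsPaths Φ S :=
  fun _ ha _ hb => h (hST ha) (hST hb)

theorem reflectsPaths_of_pathConvex_image (h : PathConvex H (Φ '' S)) : ReflectsPaths Φ S :=
  fun _ ha _ hb p hp => exists_walk_map_eq Φ p fun z hz =>
    Set.image_subset_range _ _ (h ⟨_, ha, rfl⟩ ⟨_, hb, rfl⟩ p hp z hz)

theorem OddPaths.image (h : OddPaths G S) (hΦ : ReflectsPaths Φ S) : OddPaths H (Φ '' S) := by
  rintro _ ⟨x, hx, rfl⟩ _ ⟨y, hy, rfl⟩ hxy p hp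
  obtain ⟨q, rfl⟩ := hΦ hx hy p hp
  rw [Walk.length_map]
  exact h hx hy (fun h => hxy (congrArg Φ h)) q
    ((Walk.isPath_map_iff_of_injective Φ.injective).1 hp)

end ReflectsPaths

theorem not_hasOpenEar_map {V W : Type u} {G : SimpleGraph V} {H : SimpleGraph W} {Φ : G ↪g H}
    {K : G.Subgraph} (hΦ : ReflectsPaths Φ K.verts) (hK : ¬ HasOpenEar K) :
    ¬ HasOpenEar (K.map Φ.toHom) := by
  rintro ⟨a, b, p, hp, hlen, hverts, hedges⟩
  obtain ⟨a, ha, rfl⟩ : a ∈ Φ '' K.verts := (hverts a p.start_mem_support).2 (Or.inl rfl)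
  obtain ⟨b, hb, rfl⟩ : b ∈ Φ '' K.verts := (hverts b p.end_mem_support).2 (Or.inr rfl)
  obtain ⟨q, rfl⟩ := hΦ ha hb p hp
  refine hK ⟨a, b, q, (Walk.isPath_map_iff_of_injective Φ.injective).1 hp, by simpa using hlen,
    fun w hw => ?_, fun e hq hKe => ?_⟩
  · have hΦw : Φ w ∈ (q.map Φ.toHom).support := by
      rw [Walk.support_map]
      exact List.mem_map_of_mem hw
    have h : Φ w ∈ Φ '' K.verts ↔ Φ w = Φ a ∨ Φ w = Φ b := hverts _ hΦw
    rwa [Φ.injective.mem_set_image, Φ.injective.eq_iff, Φ.injective.eq_iff] at h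
  · refine hedges (e.map Φ) ?_ ?_
    · rw [Walk.edges_map]
      exact List.mem_map_of_mem hq
    · induction e with
      | h x y => exact ⟨x, y, hKe, rfl, rfl⟩

section Containment

variable {V W : Type u} {G : SimpleGraph V} {H : SimpleGraph W}

theorem IsRayless.of_isContained (hH : IsRayless H) (h : G ⊑ H) : IsRayless G := by
  obtain ⟨f⟩ := h
  rintro ⟨r, hr, hadj⟩
  exact hH ⟨f ∘ r, f.injective.comp hr, fun n => f.toHom.map_adj (hadj n)⟩

theorem mem_raylessClass_of_isContained {κ : Cardinal.{u}} {𝒦 : Set Grph.{v}}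
    (hH : ⟨W, H⟩ ∈ raylessClass κ 𝒦) (h : G ⊑ H) (hG : G.Connected) :
    ⟨V, G⟩ ∈ raylessClass κ 𝒦 := by
  obtain ⟨-, hcard, hray, hfree⟩ := hH
  obtain ⟨f⟩ := id h
  exact ⟨hG, (mk_le_of_injective f.injective).trans hcard, hray.of_isContained h,
    fun K hK hKG => hfree K hK (hKG.trans h)⟩

end Containment

theorem mk_component_induce_le {V : Type u} (G : SimpleGraph V) (A : Set V) :
    #(G.induce A).ConnectedComponent ≤ #V :=
  (mk_le_of_surjective (f := (G.induce A).connectedComponentMk) Quot.mk_surjective).trans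
    (mk_set_le A)

section Rank

variable {V W : Type u} {G : SimpleGraph V} {H : SimpleGraph W} {α β : Ordinal.{u}}

/-- `G` has some rank that is smaller than `α`, so that `raylessClassBelow κ α 𝒦` consists of the
members `G` of `raylessClass κ 𝒦` with `RankLT α G.graph`. -/
def RankLT (α : Ordinal.{u}) (G : SimpleGraph V) : Prop :=
  ∃ β, β < α ∧ HasRank β G

theorem RankLT.mono (h : RankLT β G) (hβα : β ≤ α) : RankLT α G :=
  let ⟨γ, hγ, h⟩ := h
  ⟨γ, hγ.trans_le hβα, h⟩

theorem HasRank.exists_finite_forall_rankLT (h : HasRank α G) :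
    ∃ F : Set V, F.Finite ∧
      ∀ C : (G.induce Fᶜ).ConnectedComponent, RankLT α C.toSimpleGraph := by
  rcases eq_or_ne α 0 with rfl | hα
  · have := (hasRank_zero_iff G).1 h
    refine ⟨Set.univ, Set.finite_univ, fun C => ?_⟩
    obtain ⟨x, -⟩ := C.exists_rep
    exact absurd (Set.mem_univ x.1) x.2
  · exact ((hasRank_iff_of_ne_zero hα G).1 h).2

theorem rankLT_succ_of_forall_rankLT {F : Set V} (hF : F.Finite)
    (hC : ∀ C : (G.induce Fᶜ).ConnectedComponent, RankLT α C.toSimpleGraph) :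
    RankLT (Order.succ α) G := by
  by_cases hG : RankLT α G
  · exact hG.mono (Order.le_succ α)
  refine ⟨α, Order.lt_succ α, ?_⟩
  rcases eq_or_ne α 0 with rfl | hα
  · rw [hasRank_zero_iff]
    refine Set.finite_univ_iff.1 (hF.subset fun x _ => ?_)
    by_contra hx
    obtain ⟨β, hβ, -⟩ := hC ((G.induce Fᶜ).connectedComponentMk ⟨x, hx⟩)
    exact not_lt_zero hβ
  · exact (hasRank_iff_of_ne_zero hα G).2 ⟨fun β hβ h => hG ⟨β, hβ, h⟩, F, hF, hC⟩

theorem rankLT_succ_iff : RankLT (Order.succ α) G ↔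
    ∃ F : Set V, F.Finite ∧
      ∀ C : (G.induce Fᶜ).ConnectedComponent, RankLT α C.toSimpleGraph := by
  refine ⟨?_, fun ⟨F, hF, hC⟩ => rankLT_succ_of_forall_rankLT hF hC⟩
  rintro ⟨β, hβ, h⟩
  obtain ⟨F, hF, hC⟩ := h.exists_finite_forall_rankLT
  exact ⟨F, hF, fun C => (hC C).mono (Order.lt_succ_iff.1 hβ)⟩

theorem RankLT.exists_lt (h : RankLT α G) : ∃ β < α, RankLT (Order.succ β) G :=
  let ⟨β, hβ, h⟩ := h
  ⟨β, hβ, β, Order.lt_succ β, h⟩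

theorem isContained_component_map {A B : Type*} {G : SimpleGraph A} {H : SimpleGraph B}
    (f : G.Copy H) (C : G.ConnectedComponent) :
    C.toSimpleGraph ⊑ (C.map f.toHom).toSimpleGraph :=
  ⟨⟨fun x => ⟨f x.1, congrArg (ConnectedComponent.map f.toHom) x.2⟩,
    fun {x y} h => f.toHom.map_adj (v := x.1) (w := y.1) h⟩,
    fun _ _ hxy => Subtype.ext (f.injective (congrArg Subtype.val hxy))⟩

theorem isContained_of_range_subset {A B C : Type*} {G : SimpleGraph A} {H : SimpleGraph B}
    {L : SimpleGraph C} (f : G →g L) (hf : Function.Injective f) (g : H ↪g L)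
    (h : ∀ x, f x ∈ Set.range g) : G ⊑ H := by
  choose k hk using h
  refine ⟨⟨k, fun {x y} hxy => ?_⟩, fun x y hxy => hf ?_⟩
  · rw [← g.map_adj_iff, hk, hk]
    exact f.map_adj hxy
  · rw [← hk x, ← hk y]
    exact congrArg g hxy

theorem RankLT.of_isContained (hH : RankLT α H) (h : G ⊑ H) : RankLT α G := by
  induction α using WellFoundedLT.induction generalizing V W with
  | ind α ih =>
    obtain ⟨f⟩ := h
    obtain ⟨β, hβ, hH⟩ := hH.exists_lt
    obtain ⟨F, hF, hC⟩ := rankLT_succ_iff.1 hH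
    let f' : (G.induce (f ⁻¹' F)ᶜ).Copy (H.induce Fᶜ) :=
      ⟨⟨fun x => ⟨f x, x.2⟩, fun h => f.toHom.map_adj h⟩,
        fun x y hxy => Subtype.ext (f.injective (congrArg Subtype.val hxy))⟩
    refine (rankLT_succ_of_forall_rankLT (hF.preimage f.injective.injOn) fun C => ?_).mono
      (Order.succ_le_of_lt hβ)
    exact ih β hβ (hC (C.map f'.toHom)) (isContained_component_map f' C)

theorem RankLT.exists_finite_forall_superset (hG : RankLT (Order.succ α) G) :
    ∃ F : Set V, F.Finite ∧ ∀ S, F ⊆ S → ∀ C : (G.induce Sᶜ).ConnectedComponent,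
      RankLT α C.toSimpleGraph := by
  obtain ⟨F, hF, hC⟩ := rankLT_succ_iff.1 hG
  exact ⟨F, hF, fun S hFS C => (hC _).of_isContained <|
    isContained_component_map (induceHomOfLE G (Set.compl_subset_compl.2 hFS)).toCopy C⟩

end Rank

section RankExistence

variable {μ : Cardinal.{u}}

theorem exists_lt_ord_forall_le (hμ : μ.IsRegular) {ι : Type u} (hι : #ι < μ)
    {f : ι → Ordinal.{u}} (hf : ∀ i, f i < μ.ord) : ∃ β < μ.ord, ∀ i, f i ≤ β :=
  ⟨iSup f, Ordinal.iSup_lt_of_lt_cof (hμ.cof_ord.symm ▸ hι) hf, Ordinal.le_iSup f⟩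

variable {V : Type u} {G : SimpleGraph V}

theorem rankLT_ord_of_forall_rankLT_ord (hμ : μ.IsRegular) (hV : #V < μ) {F : Set V}
    (hF : F.Finite) (hC : ∀ C : (G.induce Fᶜ).ConnectedComponent, RankLT μ.ord C.toSimpleGraph) :
    RankLT μ.ord G := by
  choose f hfμ hf using hC
  obtain ⟨β, hβ, hfβ⟩ := exists_lt_ord_forall_le hμ ((mk_component_induce_le G Fᶜ).trans_lt hV) hfμ
  have hlim := isSuccLimit_ord hμ.aleph0_le
  exact (rankLT_succ_of_forall_rankLT hF fun C => ⟨f C, Order.lt_succ_iff.2 (hfβ C), hf C⟩).mono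
    (hlim.succ_lt (hlim.succ_lt hβ)).le

-- The vertices of an infinite descending chain would form a ray.
theorem IsRayless.wellFounded (hG : IsRayless G) :
    WellFounded fun s t : V × Set V => s.1 ∈ s.2 ∧ s.2 ⊆ t.2 ∧ t.1 ∉ s.2 ∧ G.Adj t.1 s.1 := by
  refine wellFounded_iff_isEmpty_descending_chain.2 ⟨fun ⟨s, hs⟩ => hG ⟨fun n => (s n).1, ?_,
    fun n => (hs n).2.2.2⟩⟩
  have hanti : Antitone fun n => (s n).2 := antitone_nat_of_succ_le fun n => (hs n).2.1
  refine .of_lt_imp_ne fun m n hmn h => (hs m).2.2.1 ?_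
  obtain ⟨k, rfl⟩ := Nat.exists_eq_add_of_lt hmn
  exact hanti (Nat.succ_le_of_lt hmn) (h ▸ (hs (m + k)).1)

theorem rankLT_ord_of_isRayless (hμ : μ.IsRegular) (hG : G.Connected) (hV : #V < μ)
    (hray : IsRayless G) : RankLT μ.ord G := by
  suffices ∀ s : V × Set V, s.1 ∈ s.2 → (G.induce s.2).Connected → RankLT μ.ord (G.induce s.2) by
    obtain ⟨r⟩ := hG.nonempty
    have e := induceUnivIso G
    exact (this (r, Set.univ) trivial (e.connected_iff.2 hG)).of_isContained e.symm.isContained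
  intro s
  induction s using hray.wellFounded.induction with
  | _ s ih =>
    obtain ⟨v, A⟩ := s
    intro (hv : v ∈ A) hA
    refine rankLT_ord_of_forall_rankLT_ord hμ ((mk_set_le A).trans_lt hV)
      (Set.finite_singleton ⟨v, hv⟩) fun C => ?_
    obtain ⟨_, rfl, x, hx⟩ :=
      exists_adj_componentEmbedding hA.preconnected (Set.singleton_nonempty ⟨v, hv⟩) C
    let f : C.toSimpleGraph ↪g G := (Embedding.induce A).comp (componentEmbedding C)
    have hfA : Set.range f ⊆ A := by
      rintro _ ⟨y, rfl⟩
      exact (componentEmbedding C y).2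
    have hvf : v ∉ Set.range f := by
      rintro ⟨y, hy⟩
      exact componentEmbedding_mem C y (Subtype.ext hy)
    exact (ih (f x, Set.range f) ⟨⟨x, rfl⟩, hfA, hvf, hx⟩ ⟨x, rfl⟩
      (f.isoInduceRange.connected_iff.1 C.connected_toSimpleGraph)).of_isContained
      f.isoInduceRange.isContained

theorem raylessClass_eq_raylessClassBelow {κ : Cardinal.{u}} (hκ : ℵ₀ ≤ κ) (𝒦 : Set Grph.{v}) :
    raylessClass κ 𝒦 = raylessClassBelow κ (Order.succ κ).ord 𝒦 := by
  refine Set.Subset.antisymm (fun G hG => ⟨hG, ?_⟩) fun G hG => hG.1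
  exact rankLT_ord_of_isRayless (isRegular_succ hκ) hG.1 (Order.lt_succ_iff.2 hG.2.1) hG.2.2.1

end RankExistence

section FiniteDeletion

variable {V : Type u} {G : SimpleGraph V}

theorem isRayless_of_forall_component {F : Set V} (hF : F.Finite)
    (hC : ∀ C : (G.induce Fᶜ).ConnectedComponent, IsRayless C.toSimpleGraph) : IsRayless G := by
  rintro ⟨r, hr, hadj⟩
  obtain ⟨m, hm⟩ := (hF.preimage hr.injOn).bddAbove
  have htail : ∀ n, r (m + 1 + n) ∈ Fᶜ := fun n hn => by
    have : m + 1 + n ≤ m := hm hn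
    omega
  let t : ℕ → ↥Fᶜ := fun n => ⟨r (m + 1 + n), htail n⟩
  have ht : ∀ n, (G.induce Fᶜ).Adj (t n) (t (n + 1)) := fun n => hadj (m + 1 + n)
  have hcomp : ∀ n, t n ∈ ((G.induce Fᶜ).connectedComponentMk (t 0)).supp := by
    intro n
    induction n with
    | zero => exact ConnectedComponent.connectedComponentMk_mem
    | succ n ih => exact ConnectedComponent.mem_supp_of_adj_mem_supp _ ih (ht n)
  refine hC _ ⟨fun n => ⟨t n, hcomp n⟩, fun n k h => ?_, ht⟩
  have : m + 1 + n = m + 1 + k := hr (congrArg (fun x => x.1.1) h)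
  omega

end FiniteDeletion

section Glue

variable {V₀ J : Type*} {V : J → Type*} (G₀ : SimpleGraph V₀) (P : ∀ j, SimpleGraph (V j))
  (b : J → V₀) (N : ∀ j, Set (V j))

/-- The adjacency relation of `glue`. -/
inductive GlueAdj : V₀ ⊕ (Σ j, V j) → V₀ ⊕ (Σ j, V j) → Prop
  | core {x y : V₀} : G₀.Adj x y → GlueAdj (.inl x) (.inl y)
  | piece {j : J} {x y : V j} : (P j).Adj x y → GlueAdj (.inr ⟨j, x⟩) (.inr ⟨j, y⟩)
  | up {j : J} {x : V j} : x ∈ N j → GlueAdj (.inl (b j)) (.inr ⟨j, x⟩)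
  | down {j : J} {x : V j} : x ∈ N j → GlueAdj (.inr ⟨j, x⟩) (.inl (b j))

/-- The graph obtained from the core `G₀` and the disjoint pieces `P j` by joining the vertex `b j`
of the core to the vertices in the set `N j` of the piece `P j`, for every `j`. -/
def glue : SimpleGraph (V₀ ⊕ (Σ j, V j)) where
  Adj := GlueAdj G₀ P b N
  symm := ⟨fun x y h => by
    cases h with
    | core h => exact .core h.symm
    | piece h => exact .piece h.symm
    | up h => exact .down h
    | down h => exact .up h⟩
  loopless := ⟨fun x h => by
    cases h with
    | core h => exact h.ne rfl
    | piece h => exact h.ne rfl⟩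

/-- The core of a glued graph. -/
def glueCore : G₀ ↪g glue G₀ P b N where
  toFun := .inl
  inj' := Sum.inl_injective
  map_rel_iff' := ⟨fun h => by cases h; assumption, .core⟩

/-- The pieces of a glued graph. -/
def gluePiece (j : J) : P j ↪g glue G₀ P b N where
  toFun x := .inr ⟨j, x⟩
  inj' x y h := by simpa using h
  map_rel_iff' := ⟨fun h => by cases h; assumption, .piece⟩

variable {G₀ P b N}

theorem glue_adj_inl_inr {x : V₀} {j : J} {y : V j} :
    (glue G₀ P b N).Adj (.inl x) (.inr ⟨j, y⟩) ↔ b j = x ∧ y ∈ N j := by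
  constructor
  · rintro (_ | _ | h | _)
    exact ⟨rfl, h⟩
  · rintro ⟨rfl, h⟩
    exact .up h

theorem fst_eq_of_glue_adj {z w : Σ j, V j} (h : (glue G₀ P b N).Adj (.inr z) (.inr w)) :
    z.1 = w.1 := by
  cases h
  rfl

theorem isAttachedAt_range_gluePiece (j : J) :
    IsAttachedAt (glue G₀ P b N) (Set.range (gluePiece G₀ P b N j)) (.inl (b j)) := by
  refine ⟨?_, ?_⟩
  · rintro ⟨_, ⟨⟩⟩
  rintro _ ⟨x, rfl⟩ y hy h
  cases h with
  | piece h => exact absurd ⟨_, rfl⟩ hy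
  | down h => rfl

theorem pathConvex_range_glueCore :
    PathConvex (glue G₀ P b N) (Set.range (glueCore G₀ P b N)) := by
  rintro _ ⟨a, rfl⟩ _ ⟨a', rfl⟩ p hp (x | ⟨j, x⟩) hx
  · exact ⟨x, rfl⟩
  · have hcore : ∀ y, glueCore G₀ P b N y ∉ Set.range (gluePiece G₀ P b N j) :=
      fun _ ⟨_, h⟩ => by cases h
    exact absurd hx ((isAttachedAt_range_gluePiece j).notMem_support_of_isPath hp (hcore a)
      (hcore a') ⟨x, rfl⟩)

theorem oddCycles_glue (h₀ : OddCycles G₀) (hP : ∀ j, OddCycles (P j))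
    (hN : ∀ j, OddPaths (P j) (N j)) : OddCycles (glue G₀ P b N) := by
  intro a c hc
  by_cases hcore : ∀ x ∈ c.support, x ∈ Set.range (glueCore G₀ P b N)
  · obtain ⟨a, rfl⟩ := hcore a c.start_mem_support
    obtain ⟨d, rfl⟩ := exists_walk_map_eq _ c hcore
    rw [Walk.length_map]
    exact h₀ d ((Walk.isCycle_map_iff_of_injective (glueCore G₀ P b N).injective).1 hc)
  · push Not at hcore
    obtain ⟨x | ⟨j, x⟩, hxc, hx⟩ := hcore
    · exact absurd ⟨x, rfl⟩ hx
    have hnbrs : {x | (glue G₀ P b N).Adj (.inl (b j)) (gluePiece G₀ P b N j x)} = N j :=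
      Set.ext fun x => glue_adj_inl_inr.trans (and_iff_right rfl)
    exact (hP j).odd_length_of_support_subset_insert _ (hnbrs ▸ hN j) hc
      ((isAttachedAt_range_gluePiece j).support_subset_insert_of_isCycle hc ⟨x, rfl⟩ hxc)

theorem connected_glue (h₀ : G₀.Connected) (hP : ∀ j, (P j).Connected)
    (hN : ∀ j, (N j).Nonempty) : (glue G₀ P b N).Connected := by
  obtain ⟨r⟩ := h₀.nonempty
  have hcore : ∀ x, (glue G₀ P b N).Reachable (.inl r) (.inl x) := fun x =>
    (h₀.preconnected r x).map (glueCore G₀ P b N).toHom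
  refine (connected_iff_exists_forall_reachable _).2 ⟨.inl r, ?_⟩
  rintro (x | ⟨j, x⟩)
  · exact hcore x
  · obtain ⟨y, hy⟩ := hN j
    have hby : (glue G₀ P b N).Reachable (.inl (b j)) (.inr ⟨j, y⟩) := Adj.reachable (.up hy)
    exact ((hcore (b j)).trans hby).trans
      (((hP j).preconnected y x).map (gluePiece G₀ P b N j).toHom)

theorem exists_component_glue_isContained
    (C : ((glue G₀ P b N).induce (Set.range (glueCore G₀ P b N))ᶜ).ConnectedComponent) :
    ∃ j, C.toSimpleGraph ⊑ P j := by
  obtain ⟨x, hx⟩ := C.connected_toSimpleGraph.nonempty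
  obtain ⟨x | ⟨j, x⟩, hxcore⟩ := x
  · exact absurd ⟨x, rfl⟩ hxcore
  refine ⟨j, isContained_of_range_subset (componentEmbedding C).toHom
    (componentEmbedding C).injective (gluePiece G₀ P b N j) fun y => ?_⟩
  by_contra hy
  obtain ⟨p⟩ := C.connected_toSimpleGraph.preconnected ⟨_, hx⟩ y
  have hb := (isAttachedAt_range_gluePiece j).mem_support
    (p.map (componentEmbedding C).toHom) ⟨x, rfl⟩ hy
  rw [Walk.support_map, List.mem_map] at hb
  obtain ⟨z, -, hz⟩ := hb
  exact componentEmbedding_mem C z ⟨b j, hz.symm⟩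

end Glue

section GlueMap

variable {V₀ W₀ J K : Type*} {V : J → Type*} {W : K → Type*} {G₀ : SimpleGraph V₀}
  {P : ∀ j, SimpleGraph (V j)} {b : J → V₀} {N : ∀ j, Set (V j)} {H₀ : SimpleGraph W₀}
  {Q : ∀ k, SimpleGraph (W k)} {c : K → W₀} {M : ∀ k, Set (W k)}

/-- Compatible embeddings of the core and of the pieces of a glued graph yield an embedding of the
glued graph. -/
def glueMap (e : G₀ ↪g H₀) (σ : J ↪ K) (φ : ∀ j, P j ↪g Q (σ j)) (hb : ∀ j, c (σ j) = e (b j))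
    (hN : ∀ j x, φ j x ∈ M (σ j) ↔ x ∈ N j) : glue G₀ P b N ↪g glue H₀ Q c M where
  toFun := Sum.map e (Sigma.map σ fun j => φ j)
  inj' := e.injective.sumMap (σ.injective.sigma_map fun j => (φ j).injective)
  map_rel_iff' {x y} := by
    have hbe : ∀ j x, c (σ j) = e x ↔ b j = x := fun j x => by rw [hb, e.injective.eq_iff]
    rcases x with x | ⟨j, x⟩ <;> rcases y with y | ⟨k, y⟩
    · exact (glueCore H₀ Q c M).map_adj_iff.trans
        (e.map_adj_iff.trans (glueCore G₀ P b N).map_adj_iff.symm)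
    · exact glue_adj_inl_inr.trans
        ((and_congr (hbe k x) (hN k y)).trans glue_adj_inl_inr.symm)
    · rw [adj_comm, adj_comm (glue G₀ P b N)]
      exact glue_adj_inl_inr.trans
        ((and_congr (hbe j y) (hN j x)).trans glue_adj_inl_inr.symm)
    · rcases eq_or_ne j k with rfl | hjk
      · exact (gluePiece H₀ Q c M (σ j)).map_adj_iff.trans
          ((φ j).map_adj_iff.trans (gluePiece G₀ P b N j).map_adj_iff.symm)
      · exact iff_of_false (fun h => hjk (σ.injective (fst_eq_of_glue_adj h)))
          fun h => hjk (fst_eq_of_glue_adj h)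

end GlueMap

section GlueComponents

variable {V : Type*} {G : SimpleGraph V} {S : Set V}

theorem sigma_componentEmbedding_injective {A : Set V} : Function.Injective
    fun z : Σ C : (G.induce A).ConnectedComponent, C => componentEmbedding z.1 z.2 := by
  rintro ⟨C, x, hx⟩ ⟨D, y, hy⟩ h
  obtain rfl : x = y := Subtype.ext h
  obtain rfl := hx
  obtain rfl := hy
  rfl

theorem eq_of_componentEmbedding_adj {C D : (G.induce Sᶜ).ConnectedComponent} {x} {y}
    (h : G.Adj (componentEmbedding C x) (componentEmbedding D y)) : C = D := by
  by_cases hy : componentEmbedding D y ∈ Set.range (componentEmbedding C)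
  · obtain ⟨z, hz⟩ := hy
    exact congrArg Sigma.fst (sigma_componentEmbedding_injective (a₁ := ⟨C, z⟩) (a₂ := ⟨D, y⟩) hz)
  · exact absurd (mem_of_adj_componentEmbedding h hy) (componentEmbedding_mem D y)

/-- If every component of `G - S` is attached at a single vertex of `S`, then `G` arises from the
subgraph induced on `S` by gluing these components. -/
noncomputable def glueComponentsIso (v : (G.induce Sᶜ).ConnectedComponent → S)
    (hv : ∀ C, IsAttachedAt G (Set.range (componentEmbedding C)) (v C)) :
    glue (G.induce S) (fun C => C.toSimpleGraph) v
      (fun C => {x | G.Adj (v C) (componentEmbedding C x)}) ≃g G where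
  toEquiv := Equiv.ofBijective (Sum.elim (↑) fun z => componentEmbedding z.1 z.2) <| by
    refine ⟨Subtype.val_injective.sumElim sigma_componentEmbedding_injective ?_, fun x => ?_⟩
    · exact fun x z h => componentEmbedding_mem z.1 z.2 (h ▸ x.2)
    · by_cases hx : x ∈ S
      · exact ⟨.inl ⟨x, hx⟩, rfl⟩
      · exact ⟨.inr ⟨_, ⟨x, hx⟩, rfl⟩, rfl⟩
  map_rel_iff' {x y} := by
    have hmix : ∀ (s : S) (C : (G.induce Sᶜ).ConnectedComponent) (z),
        G.Adj s (componentEmbedding C z) ↔ v C = s ∧ G.Adj (v C) (componentEmbedding C z) := by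
      refine fun s C z => ⟨fun h => ?_, fun ⟨hs, h⟩ => hs ▸ h⟩
      have hs : (s : V) = v C := (hv C).2 ⟨z, rfl⟩
        (fun ⟨y, hy⟩ => componentEmbedding_mem C y (hy ▸ s.2)) h.symm
      exact ⟨Subtype.ext hs.symm, hs ▸ h⟩
    rcases x with x | ⟨C, x⟩ <;> rcases y with y | ⟨D, y⟩
    · exact ((glueCore (G.induce S) _ _ _).map_adj_iff (v := x) (w := y)).symm
    · rw [glue_adj_inl_inr]
      exact hmix x D y
    · rw [adj_comm, adj_comm (glue ..), glue_adj_inl_inr]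
      exact hmix y C x
    · rcases eq_or_ne C D with rfl | hCD
      · exact (componentEmbedding C).map_adj_iff.trans (gluePiece ..).map_adj_iff.symm
      · exact iff_of_false (fun h => hCD (eq_of_componentEmbedding_adj h))
          fun h => hCD (fst_eq_of_glue_adj h)

theorem exists_embedding_glue_reflectsPaths {W₀ K : Type*} {W : K → Type*} {H₀ : SimpleGraph W₀}
    {Q : ∀ k, SimpleGraph (W k)} {c : K → W₀} {M : ∀ k, Set (W k)} (e : G.induce S ≃g H₀)
    {v : (G.induce Sᶜ).ConnectedComponent → S}
    (hv : ∀ C, IsAttachedAt G (Set.range (componentEmbedding C)) (v C))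
    (σ : (G.induce Sᶜ).ConnectedComponent ↪ K) (φ : ∀ C, C.toSimpleGraph ↪g Q (σ C))
    (hc : ∀ C, c (σ C) = e (v C))
    (hM : ∀ C x, φ C x ∈ M (σ C) ↔ G.Adj (v C) (componentEmbedding C x)) :
    ∃ Φ : G ↪g glue H₀ Q c M, ReflectsPaths Φ S := by
  let I := glueComponentsIso v hv
  let Φ : G ↪g glue H₀ Q c M := (glueMap e.toEmbedding σ φ hc hM).comp I.symm.toEmbedding
  have hcore (s : S) : Φ s = glueCore H₀ Q c M (e s) :=
    congrArg (glueMap e.toEmbedding σ φ hc hM) (I.symm_apply_apply (.inl s))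
  refine ⟨Φ, reflectsPaths_of_pathConvex_image ?_⟩
  convert pathConvex_range_glueCore (G₀ := H₀) (P := Q) (b := c) (N := M)
  ext x
  constructor
  · rintro ⟨s, hs, rfl⟩
    exact ⟨e ⟨s, hs⟩, (hcore ⟨s, hs⟩).symm⟩
  · rintro ⟨y, rfl⟩
    obtain ⟨s, rfl⟩ := e.surjective y
    exact ⟨s, s.2, hcore s⟩

end GlueComponents

section GlueClass

variable {V₀ : Type} [Finite V₀] {J : Type u} {V : J → Type u} {G₀ : SimpleGraph V₀}
  {P : ∀ j, SimpleGraph (V j)} {b : J → V₀} {N : ∀ j, Set (V j)} {κ : Cardinal.{u}}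

theorem isRayless_glue (hP : ∀ j, IsRayless (P j)) : IsRayless (glue G₀ P b N) :=
  isRayless_of_forall_component (Set.finite_range _) fun C =>
    let ⟨j, hj⟩ := exists_component_glue_isContained C
    (hP j).of_isContained hj

theorem rankLT_succ_glue {α : Ordinal.{u}} (hP : ∀ j, RankLT α (P j)) :
    RankLT (Order.succ α) (glue G₀ P b N) :=
  rankLT_succ_of_forall_rankLT (Set.finite_range _) fun C =>
    let ⟨j, hj⟩ := exists_component_glue_isContained C
    (hP j).of_isContained hj

theorem mk_sigma_le_of_le (hκ : ℵ₀ ≤ κ) (hJ : #J ≤ κ) (hV : ∀ j, #(V j) ≤ κ) :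
    #(Σ j, V j) ≤ κ := by
  rw [mk_sigma]
  exact (sum_le_mk_mul_iSup _).trans (mul_le_of_le hκ hJ (ciSup_le' hV))

theorem mk_glue_le (hκ : ℵ₀ ≤ κ) (hJ : #J ≤ κ) (hV : ∀ j, #(V j) ≤ κ) :
    #(V₀ ⊕ (Σ j, V j)) ≤ κ := by
  rw [mk_sum, Cardinal.lift_id']
  exact add_le_of_le hκ ((lift_lt_aleph0.2 (lt_aleph0_of_finite V₀)).le.trans hκ)
    (mk_sigma_le_of_le hκ hJ hV)

theorem glue_mem_raylessClassBelow_succ (hκ : ℵ₀ ≤ κ) (hJ : #J ≤ κ) (h₀ : G₀.Connected)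
    (hodd : OddCycles G₀) {α : Ordinal.{u}}
    (hP : ∀ j, ⟨V j, P j⟩ ∈ raylessClassBelow κ α evenCycles) (hne : ∀ j, (N j).Nonempty)
    (hN : ∀ j, OddPaths (P j) (N j)) :
    ⟨_, glue G₀ P b N⟩ ∈ raylessClassBelow κ (Order.succ α) evenCycles :=
  ⟨⟨connected_glue h₀ (fun j => (hP j).1.1) hne, mk_glue_le hκ hJ fun j => (hP j).1.2.1,
    isRayless_glue fun j => (hP j).1.2.2.1,
    isFreeOf_evenCycles_iff.2 <|
      oddCycles_glue hodd (fun j => isFreeOf_evenCycles_iff.1 (hP j).1.2.2.2) hN⟩,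
    rankLT_succ_glue fun j => (hP j).2⟩

end GlueClass

section UniversalGlue

variable {ι : Type u} (κ : Cardinal.{u}) (V₀ : Type) (P : ι → Grph.{u})

/-- An admissible way of attaching a graph of the family `P` to a core on `V₀`: the label of one of
`κ` copies of the graph `P index`, the vertex `base` of the core to which it is attached, and the
nonempty finite set `nbrs` of vertices of `P index` that are joined to `base`. -/
structure PieceIndex : Type u where
  base : V₀
  copy : κ.out
  index : ι
  nbrs : Finset (P index).V
  nbrs_nonempty : nbrs.Nonempty
  oddPaths_nbrs : OddPaths (P index).graph nbrs

variable {V₀}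

/-- The graph with the given core to which `κ` copies of all members of the family are attached in
all admissible ways. -/
def universalGlue (G₀ : SimpleGraph V₀) : Grph.{u} :=
  ⟨_, glue G₀ (fun j : PieceIndex κ V₀ P => (P j.index).graph) (fun j => j.base) (fun j => j.nbrs)⟩

variable {κ P}

theorem mk_finset_le {α : Type u} (hκ : ℵ₀ ≤ κ) (hα : #α ≤ κ) : #(Finset α) ≤ κ := by
  cases finite_or_infinite α
  · exact (lt_aleph0_of_finite _).le.trans hκ
  · rwa [mk_finset_of_infinite]

theorem mk_pieceIndex_le [Finite V₀] (hκ : ℵ₀ ≤ κ) (hι : #ι ≤ κ) (hP : ∀ i, #(P i).V ≤ κ) :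
    #(PieceIndex κ V₀ P) ≤ κ := by
  let f : PieceIndex κ V₀ P → V₀ × κ.out × (Σ i, Finset (P i).V) := fun j =>
    (j.base, j.copy, ⟨j.index, j.nbrs⟩)
  have hf : Function.Injective f := by
    rintro ⟨_, _, _, _, _, _⟩ ⟨_, _, _, _, _, _⟩ h
    cases h
    rfl
  refine (mk_le_of_injective hf).trans ?_
  rw [mk_prod, mk_prod, Cardinal.lift_id', Cardinal.lift_id, Cardinal.lift_id, mk_out]
  exact mul_le_of_le hκ ((lift_lt_aleph0.2 (lt_aleph0_of_finite V₀)).le.trans hκ)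
    (mul_le_of_le hκ le_rfl (mk_sigma_le_of_le hκ hι fun i => mk_finset_le hκ (hP i)))

theorem PathConvex.exists_embedding_universalGlue {V : Type u} {G : SimpleGraph V}
    (hG : G.Connected) (hodd : OddCycles G) (hV : #V ≤ κ)
    {S : Set V} (hne : S.Nonempty) (hS : PathConvex G S) {G₀ : SimpleGraph V₀}
    (e : G.induce S ≃g G₀)
    (hP : ∀ (C : (G.induce Sᶜ).ConnectedComponent) {N}, Set.Finite N →
      ∃ i, ∃ φ : C.toSimpleGraph ↪g (P i).graph, ReflectsPaths φ N) :
    ∃ Φ : G ↪g (universalGlue κ P G₀).graph, ReflectsPaths Φ S := by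
  choose v hvS hv hvN using hS.exists_isAttachedAt hne hG.preconnected
  let N (C : (G.induce Sᶜ).ConnectedComponent) := {x | G.Adj (v C) (componentEmbedding C x)}
  have hN : ∀ C, (N C).Finite := fun C => hodd.finite_neighbors
    C.connected_toSimpleGraph.preconnected (componentEmbedding C).toHom
    (componentEmbedding C).injective (hv C).1
  have hNodd : ∀ C, OddPaths C.toSimpleGraph (N C) := fun C =>
    hodd.oddPaths_neighbors (componentEmbedding C).toHom (componentEmbedding C).injective (hv C).1
  choose i φ hφ using fun C => hP C (hN C)
  obtain ⟨copy⟩ : Nonempty ((G.induce Sᶜ).ConnectedComponent ↪ κ.out) := by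
    rw [← Cardinal.le_def, mk_out]
    exact (mk_component_induce_le G Sᶜ).trans hV
  let σ : (G.induce Sᶜ).ConnectedComponent ↪ PieceIndex κ V₀ P :=
    { toFun C :=
        { base := e ⟨v C, hvS C⟩
          copy := copy C
          index := i C
          nbrs := ((hN C).image (φ C)).toFinset
          nbrs_nonempty := (Set.Finite.toFinset_nonempty _).2 (Set.Nonempty.image _ (hvN C))
          oddPaths_nbrs := by
            rw [Set.Finite.coe_toFinset]
            exact (hNodd C).image (hφ C) }
      inj' C D h := copy.injective (congrArg PieceIndex.copy h) }
  exact exists_embedding_glue_reflectsPaths e (v := fun C => ⟨v C, hvS C⟩) hv σ φ (fun _ => rfl)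
    fun C _ => (Set.Finite.mem_toFinset _).trans (φ C).injective.mem_set_image

end UniversalGlue

section Universality

variable {κ μ : Cardinal.{u}} {α : Ordinal.{u}} {F 𝒞 : Set Grph.{u}}

theorem mk_iUnion_Iio_le (hμ : ℵ₀ ≤ μ) (hα : α.card ≤ μ) {X : Type (u + 1)} {s : Set.Iio α → Set X}
    (hs : ∀ β, #(s β) ≤ lift.{u + 1} μ) : #(⋃ β, s β) ≤ lift.{u + 1} μ := by
  refine (mk_iUnion_le s).trans (mul_le_of_le (aleph0_le_lift.2 hμ) ?_ (ciSup_le' hs))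
  rw [mk_Iio_ordinal]
  exact lift_le.2 hα

theorem exists_range_eq_of_mk_le {X : Type (u + 1)} {s : Set X} (hs : #s ≤ lift.{u + 1} μ) :
    ∃ (ι : Type u) (f : ι → X), #ι ≤ μ ∧ Set.range f = s := by
  obtain ⟨ν, hν⟩ := mem_range_lift_of_le hs
  obtain ⟨e⟩ : Nonempty (ν.out ≃ s) := lift_mk_eq'.1 (by rw [mk_out, hν, lift_id'.{u, u + 1}])
  refine ⟨ν.out, fun i => e i, ?_, ?_⟩
  · rw [mk_out]
    exact lift_le.1 (hν.trans_le hs)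
  · exact (e.surjective.range_comp Subtype.val).trans Subtype.range_coe

/-- A strengthening of strong universality: every member of `𝒞` has, for each finite set of its
vertices, an embedding into a member of `F` that reflects paths on this set. -/
def IsReflectingUniversal (F 𝒞 : Set Grph.{u}) : Prop :=
  F ⊆ 𝒞 ∧ ∀ G ∈ 𝒞, ∀ S : Set G.V, S.Finite →
    ∃ H ∈ F, ∃ Φ : G.graph ↪g H.graph, ReflectsPaths Φ S

theorem IsReflectingUniversal.isStronglyUniversal (h : IsReflectingUniversal F 𝒞) :
    IsStronglyUniversal F 𝒞 :=
  ⟨h.1, fun G hG =>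
    let ⟨H, hH, Φ, _⟩ := h.2 G hG ∅ Set.finite_empty
    ⟨H, hH, ⟨Φ⟩⟩⟩

theorem IsReflectingUniversal.iUnion {ι : Sort*} {F 𝒞 : ι → Set Grph.{u}}
    (h : ∀ i, IsReflectingUniversal (F i) (𝒞 i)) :
    IsReflectingUniversal (⋃ i, F i) (⋃ i, 𝒞 i) := by
  refine ⟨Set.iUnion_mono fun i => (h i).1, fun G hG S hS => ?_⟩
  obtain ⟨i, hG⟩ := Set.mem_iUnion.1 hG
  obtain ⟨H, hH, hΦ⟩ := (h i).2 G hG S hS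
  exact ⟨H, Set.mem_iUnion_of_mem i hH, hΦ⟩

theorem raylessClassBelow_eq_iUnion (𝒦 : Set Grph.{v}) :
    raylessClassBelow κ α 𝒦 = ⋃ β : Set.Iio α, raylessClassBelow κ (Order.succ β.1) 𝒦 := by
  ext G
  rw [Set.mem_iUnion]
  constructor
  · rintro ⟨hG, hα⟩
    obtain ⟨β, hβ, h⟩ := RankLT.exists_lt hα
    exact ⟨⟨β, hβ⟩, hG, h⟩
  · rintro ⟨β, hG, h⟩
    exact ⟨hG, RankLT.mono h (Order.succ_le_of_lt β.2)⟩

theorem exists_isReflectingUniversal_of_forall_lt (hμ : ℵ₀ ≤ μ) (hα : α.card ≤ μ)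
    {𝒦 : Set Grph.{v}}
    (h : ∀ β < α, ∃ F, IsReflectingUniversal F (raylessClassBelow κ (Order.succ β) 𝒦) ∧
      #F ≤ lift.{u + 1} μ) :
    ∃ F, IsReflectingUniversal F (raylessClassBelow κ α 𝒦) ∧ #F ≤ lift.{u + 1} μ := by
  choose F hF hcard using fun β : Set.Iio α => h β β.2
  refine ⟨⋃ β, F β, ?_, mk_iUnion_Iio_le hμ hα hcard⟩
  rw [raylessClassBelow_eq_iUnion]
  exact .iUnion hF

theorem universalGlue_mem_raylessClassBelow_succ (hκ : ℵ₀ ≤ κ) {V₀ : Type} [Finite V₀]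
    {G₀ : SimpleGraph V₀} (h₀ : G₀.Connected) (hodd : OddCycles G₀) {ι : Type u} (hι : #ι ≤ κ)
    {P : ι → Grph.{u}} (hP : ∀ i, P i ∈ raylessClassBelow κ α evenCycles) :
    universalGlue κ P G₀ ∈ raylessClassBelow κ (Order.succ α) evenCycles :=
  glue_mem_raylessClassBelow_succ hκ (mk_pieceIndex_le hκ hι fun i => (hP i).1.2.1) h₀ hodd
    (fun j => hP j.index) (fun j => j.nbrs_nonempty) fun j => j.oddPaths_nbrs

theorem IsReflectingUniversal.exists_embedding_universalGlue {ι : Type u} {P : ι → Grph.{u}}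
    (hP : IsReflectingUniversal (Set.range P) (raylessClassBelow κ α evenCycles)) {G : Grph.{u}}
    (hG : G ∈ raylessClassBelow κ (Order.succ α) evenCycles) {S₀ : Set G.V} (hS₀ : S₀.Finite) :
    ∃ (n : ℕ) (G₀ : SimpleGraph (Fin n)), G₀.Connected ∧ OddCycles G₀ ∧
      ∃ Φ : G.graph ↪g (universalGlue κ P G₀).graph, ReflectsPaths Φ S₀ := by
  obtain ⟨⟨hconn, hcard, -, hfree⟩, hrank⟩ := id hG
  have hodd := isFreeOf_evenCycles_iff.1 hfree
  obtain ⟨F, hF, hC⟩ := RankLT.exists_finite_forall_superset hrank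
  obtain ⟨S, hsub, hfin, hne, hS⟩ := hodd.exists_finite_pathConvex_superset hconn (hF.union hS₀)
  rw [Set.union_subset_iff] at hsub
  have := hfin.to_subtype
  obtain ⟨n, ⟨e⟩⟩ := Finite.exists_equiv_fin S
  let e' : G.graph.induce S ≃g (G.graph.induce S).map e.toEmbedding := Iso.map e _
  have hinduce := hS.induce_connected hconn.preconnected hne
  obtain ⟨Φ, hΦ⟩ := hS.exists_embedding_universalGlue hconn hodd hcard hne e' fun C N hN => by
    have hCmem : ⟨_, C.toSimpleGraph⟩ ∈ raylessClass κ evenCycles :=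
      mem_raylessClass_of_isContained hG.1 (componentEmbedding C).isContained
        C.connected_toSimpleGraph
    obtain ⟨_, ⟨i, rfl⟩, hi⟩ := hP.2 _ ⟨hCmem, hC S hsub.1 C⟩ N hN
    exact ⟨i, hi⟩
  exact ⟨n, _, e'.connected_iff.1 hinduce,
    hodd.of_isContained (e'.symm.isContained.trans (Embedding.induce S).isContained),
    Φ, hΦ.mono hsub.2⟩

theorem exists_isReflectingUniversal_succ (hκ : ℵ₀ ≤ κ)
    (h : ∃ F, IsReflectingUniversal F (raylessClassBelow κ α evenCycles) ∧
      #F ≤ lift.{u + 1} κ) :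
    ∃ F, IsReflectingUniversal F (raylessClassBelow κ (Order.succ α) evenCycles) ∧
      #F ≤ lift.{u + 1} κ := by
  obtain ⟨F, hF, hcard⟩ := h
  obtain ⟨ι, P, hι, rfl⟩ := exists_range_eq_of_mk_le hcard
  let Core := Σ n : ℕ, {G₀ : SimpleGraph (Fin n) // G₀.Connected ∧ OddCycles G₀}
  refine ⟨Set.range fun c : Core => universalGlue κ P c.2.1, ⟨?_, fun G hG S hS => ?_⟩,
    (Set.countable_range _).le_aleph0.trans (aleph0_le_lift.2 hκ)⟩
  · rintro _ ⟨⟨n, G₀, h₀, hodd⟩, rfl⟩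
    exact universalGlue_mem_raylessClassBelow_succ hκ h₀ hodd hι fun i => hF.1 ⟨i, rfl⟩
  · obtain ⟨n, G₀, h₀, hodd, hΦ⟩ := hF.exists_embedding_universalGlue hG hS
    exact ⟨_, ⟨⟨n, G₀, h₀, hodd⟩, rfl⟩, hΦ⟩

theorem card_le_of_lt_ord_succ (hα : α < (Order.succ κ).ord) : α.card ≤ κ :=
  Order.lt_succ_iff.1 (lt_ord.1 hα)

theorem exists_isReflectingUniversal_raylessClassBelow (hκ : ℵ₀ ≤ κ)
    (hα : α < (Order.succ κ).ord) :
    ∃ F, IsReflectingUniversal F (raylessClassBelow κ α evenCycles) ∧ #F ≤ lift.{u + 1} κ := by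
  induction α using WellFoundedLT.induction with
  | _ α ih =>
    exact exists_isReflectingUniversal_of_forall_lt hκ (card_le_of_lt_ord_succ hα) fun β hβ =>
      exists_isReflectingUniversal_succ hκ (ih β hβ (hβ.trans hα))

theorem exists_isReflectingUniversal_raylessClass (hκ : ℵ₀ ≤ κ) :
    ∃ F, IsReflectingUniversal F (raylessClass κ evenCycles) ∧
      #F ≤ lift.{u + 1} (Order.succ κ) := by
  have hlim := isSuccLimit_ord (hκ.trans (Order.le_succ κ))
  rw [raylessClass_eq_raylessClassBelow hκ]
  refine exists_isReflectingUniversal_of_forall_lt (hκ.trans (Order.le_succ κ))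
    (card_ord _).le fun β hβ => ?_
  obtain ⟨F, hF, hcard⟩ :=
    exists_isReflectingUniversal_raylessClassBelow hκ (hlim.succ_lt hβ)
  exact ⟨F, hF, hcard.trans (lift_le.2 (Order.le_succ κ))⟩

end Universality

section LowerBound

variable {κ : Cardinal.{u}}

theorem RankLT.of_infinite_disjoint_copies {V W : Type u} {G : SimpleGraph V} {H : SimpleGraph W}
    {α : Ordinal.{u}} (hG : RankLT (Order.succ α) G) (hH : H.Connected) {ι : Type*} [Infinite ι]
    {f : ι → H.Copy G} (hf : Pairwise fun i j => Disjoint (Set.range (f i)) (Set.range (f j))) :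
    RankLT α H := by
  obtain ⟨F, hF, hC⟩ := rankLT_succ_iff.1 hG
  obtain ⟨i, hi⟩ : ∃ i, ∀ x, f i x ∉ F := by
    by_contra! hmeet
    choose x hx using hmeet
    refine Set.infinite_of_injective_forall_mem (fun i j hij => ?_) hx hF
    by_contra hne
    exact Set.disjoint_left.1 (hf hne) ⟨x i, rfl⟩ ⟨x j, hij.symm⟩
  let f' : H →g G.induce Fᶜ := ⟨fun x => ⟨f i x, hi x⟩, fun h => (f i).toHom.map_adj h⟩
  obtain ⟨x₀⟩ := hH.nonempty
  let C := (G.induce Fᶜ).connectedComponentMk (f' x₀)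
  refine (hC C).of_isContained ⟨⟨⟨fun x => ⟨f' x, ?_⟩, fun h => f'.map_adj h⟩, fun x y hxy => ?_⟩⟩
  · exact ConnectedComponent.sound ((hH.preconnected x x₀).map f')
  · exact (f i).injective (congrArg (fun z => z.1.1) hxy)

theorem exists_mem_raylessClass_infinite_disjoint_copies (hκ : ℵ₀ ≤ κ) {ι : Type u} (hι : #ι ≤ κ)
    {P : ι → Grph.{u}} (hP : ∀ i, P i ∈ raylessClass κ evenCycles) :
    ∃ G ∈ raylessClass κ evenCycles, ∀ i, ∃ f : ℕ → (P i).graph.Copy G.graph,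
      Pairwise fun m n => Disjoint (Set.range (f m)) (Set.range (f n)) := by
  have hne : ∀ i, Nonempty (P i).V := fun i => (hP i).1.nonempty
  let Q (j : ι × ℕ) := (P j.1).graph
  let N (j : ι × ℕ) : Set (P j.1).V := {(hne j.1).some}
  have hJ : #(ι × ℕ) ≤ κ := by
    rw [mk_prod, lift_uzero, mk_nat, lift_aleph0]
    exact mul_le_of_le hκ hι hκ
  refine ⟨⟨_, glue (⊥ : SimpleGraph Unit) Q (fun _ => ()) N⟩, ?_, fun i =>
    ⟨fun n => (gluePiece _ Q _ N (i, n)).toCopy, fun m n hmn => ?_⟩⟩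
  · simp only [raylessClass_eq_raylessClassBelow hκ] at hP
    exact (glue_mem_raylessClassBelow_succ hκ hJ Connected.of_subsingleton
      oddCycles_of_subsingleton (fun j => hP j.1) (fun _ => Set.singleton_nonempty _)
      (fun j x hx y hy hxy => absurd (hx.trans hy.symm) hxy)).1
  · refine Set.disjoint_left.2 ?_
    rintro _ ⟨x, rfl⟩ ⟨y, hxy⟩
    exact hmn (congrArg (fun z => z.1.2) (Sum.inr_injective hxy)).symm

theorem lift_succ_le_mk_of_isStronglyUniversal (hκ : ℵ₀ ≤ κ) {F : Set Grph.{u}}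
    (hF : IsStronglyUniversal F (raylessClass κ evenCycles)) :
    lift.{u + 1} (Order.succ κ) ≤ #F := by
  rw [lift_succ, Order.succ_le_iff]
  by_contra! hcard
  obtain ⟨ι, P, hι, rfl⟩ := exists_range_eq_of_mk_le hcard
  have hP : ∀ i, P i ∈ raylessClass κ evenCycles := fun i => hF.1 ⟨i, rfl⟩
  obtain ⟨G, hG, hcopies⟩ := exists_mem_raylessClass_infinite_disjoint_copies hκ hι hP
  obtain ⟨_, ⟨i, rfl⟩, ⟨Φ⟩⟩ := hF.2 G hG
  obtain ⟨f, hf⟩ := hcopies i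
  have hdrop (α : Ordinal.{u}) (h : RankLT (Order.succ α) (P i).graph) : RankLT α (P i).graph :=
    (h.of_isContained Φ.isContained).of_infinite_disjoint_copies (hP i).1 hf
  have hnot (α : Ordinal.{u}) : ¬ RankLT α (P i).graph := by
    induction α using WellFoundedLT.induction with
    | _ α ih =>
      intro h
      obtain ⟨β, hβ, h⟩ := h.exists_lt
      exact ih β hβ (hdrop β h)
  exact hnot _ (rankLT_ord_of_isRayless (isRegular_succ hκ) (hP i).1
    (Order.lt_succ_iff.2 (hP i).2.1) (hP i).2.2.1)

theorem strongComplexity_eq {𝒞 F : Set Grph.{u}} {c : Cardinal.{u + 1}}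
    (hF : IsStronglyUniversal F 𝒞) (hFc : #F ≤ c)
    (hc : ∀ F', IsStronglyUniversal F' 𝒞 → c ≤ #F') : strongComplexity 𝒞 = c := by
  refine le_antisymm (le_trans (csInf_le' ⟨F, hF, rfl⟩) hFc) (le_csInf ⟨#F, F, hF, rfl⟩ ?_)
  rintro _ ⟨F', hF', rfl⟩
  exact hc F' hF'

end LowerBound

end RaylessGraphs

open RaylessGraphs in
theorem mainTheorem6 (κ : Cardinal.{u}) (hκ : ℵ₀ ≤ κ) :
    (∀ α : Ordinal.{u}, α ≠ 0 → α < (Order.succ κ).ord →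
      ∃ F : Set RaylessGraphs.Grph.{u},
        F ⊆ RaylessGraphs.raylessClassBelow κ α RaylessGraphs.evenCycles ∧
        (∀ G ∈ RaylessGraphs.raylessClassBelow κ α RaylessGraphs.evenCycles,
          ∀ K : G.graph.Subgraph, K.verts.Finite →
            ∃ H ∈ F, ∃ Φ : G.graph ↪g H.graph,
              ¬ RaylessGraphs.HasOpenEar K →
                ¬ RaylessGraphs.HasOpenEar (K.map Φ.toHom)) ∧
        #F ≤ Cardinal.lift.{u + 1} κ) ∧
    (∃ F : Set RaylessGraphs.Grph.{u},
      RaylessGraphs.IsStronglyUniversal F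
        (RaylessGraphs.raylessClass κ RaylessGraphs.evenCycles)) ∧
    RaylessGraphs.strongComplexity (RaylessGraphs.raylessClass κ RaylessGraphs.evenCycles) =
      Cardinal.lift.{u + 1} (Order.succ κ) := by
  obtain ⟨F, hF, hcard⟩ := exists_isReflectingUniversal_raylessClass hκ
  refine ⟨fun α _ hα => ?_, ⟨F, hF.isStronglyUniversal⟩, strongComplexity_eq hF.isStronglyUniversal
    hcard fun _ => lift_succ_le_mk_of_isStronglyUniversal hκ⟩
  obtain ⟨Fα, hFα, hcardα⟩ := exists_isReflectingUniversal_raylessClassBelow hκ hα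
  refine ⟨Fα, hFα.1, fun G hG K hK => ?_, hcardα⟩
  obtain ⟨H, hH, Φ, hΦ⟩ := hFα.2 G hG K.verts hK
  exact ⟨H, hH, Φ, not_hasOpenEar_map hΦ⟩
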